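/- Let $V$ be a finite-dimensional real inner product space and $a<b$. Let $C_{0,1}([a,b],V)$ be the set of continuous paths of bounded variation $x:[a,b]\to V$ with $x_a=0$. The signature of such a path is $$S(x)=\big(1,S(x)^{(1)},S(x)^{(2)},\dots\big)\in T((V)):=\prod_{k\ge 0}V^{\otimes k},\qquad S(x)^{(k)}=\int_{a<t_1<\dots<t_k<b}dx_{t_1}\otimes\cdots\otimes dx_{t_k}$$ (Lebesgue--Stieltjes integrals). Let $\mathcal C$ be the set of unparameterised paths, that is, the quotient of $C_{0,1}([a,b],V)$ by the relation $x\sim y\iff S(x)=S(y)$; the signature is well defined on $\mathcal C$. Let $\phi:\mathbb N\cup\{0\}\to[0,\infty)$ be a weight function such that $\sum_{k\ge 0}\frac{C^k\phi(k)}{(k!)^2}<\infty$ for every $C>0$. Equip each $V^{\otimes k}$ with the Hilbert--Schmidt inner product, $\langle v_1\otimes\cdots\otimes v_k,w_1\otimes\cdots\otimes w_k\rangle=\prod_i\langle v_i,w_i\rangle$, and let $T_\phi((V))$ be the Hilbert space obtained by completing the tensor algebra $T(V)=\bigoplus_{k\ge0}V^{\otimes k}$ with respect to $\langle v,w\rangle_\phi=\sum_{k\ge0}\phi(k)\langle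 v_k,w_k\rangle_{V^{\otimes k}}$ (if $\phi$ has zeros, vectors of zero seminorm are identified with $0$). Then for every $x\in\mathcal C$ the series $\sum_k S(x)^{(k)}$ converges in $T_\phi((V))$; its sum is again denoted by $S(x)$. Let $k_\phi(x,y)=\langle S(x),S(y)\rangle_\phi$ be the $\phi$-signature kernel on $\mathcal C\times\mathcal C$, and let $\mathcal H_\phi$ be its reproducing kernel Hilbert space of functions $\mathcal C\to\mathbb R$. For every $f\in\mathcal H_\phi$ there is a unique $\ell_f\in T_\phi((V))$ such that $f(x)=\langle \ell_f,S(x)\rangle_\phi$ for all $x\in\mathcal C$. Furthermore, the map $\ell_f\mapsto f$ is an isomorphism of Hilbert spaces from $T_\phi((V))$ onto $\mathcal H_\phi$: there is a linear surjective isometry $\Psi:T_\phi((V))\to\mathcal H_\phi$ with $\Psi(\ell)(x)=\langle\ell,S(x)\rangle_\phi$ for all $\ell\in T_\phi((V))$ and $x\in\mathcal C$. -/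

import Mathlib

open scoped TensorProduct NNReal RealInnerProductSpace
open MeasureTheory

noncomputable section

namespace SigKernel

universe u

/-! ### Tensor powers with the Hilbert-Schmidt inner product -/

/-- The `k`-fold tensor power `V^{⊗k}` (a copy of Mathlib's `⨂[ℝ]^k V`, which carries the projective
seminorm, so that the Hilbert-Schmidt inner product can be put on it). -/
def HSPower (V : Type u) [NormedAddCommGroup V] [InnerProductSpace ℝ V] (k : ℕ) : Type u :=
  ⨂[ℝ]^k V

section Tensor

variable (V : Type u) [NormedAddCommGroup V] [InnerProductSpace ℝ V]

instance (k : ℕ) : AddCommGroup (HSPower V k) := inferInstanceAs (AddCommGroup (⨂[ℝ]^k V))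

instance (k : ℕ) : Module ℝ (HSPower V k) := inferInstanceAs (Module ℝ (⨂[ℝ]^k V))

variable {V}

/-- The identity `⨂[ℝ]^k V ≃ V^{⊗k}` as a linear equivalence. -/
def toHS (k : ℕ) : (⨂[ℝ]^k V) ≃ₗ[ℝ] HSPower V k := LinearEquiv.refl ℝ (⨂[ℝ]^k V)

variable (V) in
/-- The bilinear form on `V^{⊗k}` with
`⟨v₁ ⊗ ⋯ ⊗ v_k, w₁ ⊗ ⋯ ⊗ w_k⟩ = ∏ i, ⟨v_i, w_i⟩`. -/
def hsForm (k : ℕ) : (⨂[ℝ]^k V) →ₗ[ℝ] (⨂[ℝ]^k V) →ₗ[ℝ] ℝ :=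
  TensorPower.pairingDual ℝ V k ∘ₗ PiTensorProduct.map (fun _ => innerₗ V)

lemma hsForm_tprod (k : ℕ) (v w : Fin k → V) :
    hsForm V k (PiTensorProduct.tprod ℝ v) (PiTensorProduct.tprod ℝ w) = ∏ i, ⟪v i, w i⟫ := by
  simp [hsForm]

lemma hsForm_symm (k : ℕ) (x y : ⨂[ℝ]^k V) : hsForm V k y x = hsForm V k x y := by
  have h : (hsForm V k).flip = hsForm V k := by
    ext v w
    simp [hsForm_tprod, real_inner_comm]
  exact congr($h x y)

lemma hsForm_self [FiniteDimensional ℝ V] (k : ℕ) (x : ⨂[ℝ]^k V) :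
    hsForm V k x x = ∑ p : Fin k → Fin (Module.finrank ℝ V),
      ((Basis.piTensorProduct fun _ : Fin k => (stdOrthonormalBasis ℝ V).toBasis).repr x p) ^ 2 := by
  set b := Basis.piTensorProduct fun _ : Fin k => (stdOrthonormalBasis ℝ V).toBasis with hb
  have key : ∀ p q, hsForm V k (b p) (b q) = if p = q then 1 else 0 := by
    intro p q
    rw [hb, Basis.piTensorProduct_apply, Basis.piTensorProduct_apply, hsForm_tprod]
    simp only [OrthonormalBasis.coe_toBasis, OrthonormalBasis.inner_eq_ite]
    rw [Fintype.prod_ite_zero]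
    simp [funext_iff]
  calc hsForm V k x x = hsForm V k (∑ p, b.repr x p • b p) (∑ q, b.repr x q • b q) := by
        rw [b.sum_repr x]
    _ = _ := by
        simp only [map_sum, map_smul, LinearMap.sum_apply, LinearMap.smul_apply, key]
        simp [pow_two]

variable [FiniteDimensional ℝ V]

/-- The Hilbert-Schmidt inner product on `V^{⊗k}`. -/
instance hsCore (k : ℕ) : InnerProductSpace.Core ℝ (HSPower V k) where
  inner x y := hsForm V k ((toHS k).symm x) ((toHS k).symm y)
  conj_inner_symm x y := hsForm_symm k _ _
  re_inner_nonneg x := by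
    rw [hsForm_self]
    exact Finset.sum_nonneg fun _ _ => sq_nonneg _
  add_left x y z := by simp
  smul_left x y r := by simp
  definite x h := by
    rw [hsForm_self, Finset.sum_eq_zero_iff_of_nonneg (fun _ _ => sq_nonneg _)] at h
    refine (LinearEquiv.map_eq_zero_iff (toHS k).symm).1 (Module.Basis.ext_elem
      (Basis.piTensorProduct fun _ : Fin k => (stdOrthonormalBasis ℝ V).toBasis) fun p => ?_)
    simpa using h p (Finset.mem_univ p)

instance (k : ℕ) : NormedAddCommGroup (HSPower V k) :=
  InnerProductSpace.Core.toNormedAddCommGroup (𝕜 := ℝ)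

instance (k : ℕ) : InnerProductSpace ℝ (HSPower V k) := InnerProductSpace.ofCore _

instance (k : ℕ) : FiniteDimensional ℝ (HSPower V k) := (toHS k).finiteDimensional

/-- The elementary tensor `v₁ ⊗ ⋯ ⊗ v_k` in `V^{⊗k}`. -/
def elem {k : ℕ} (v : Fin k → V) : HSPower V k := toHS k (PiTensorProduct.tprod ℝ v)

lemma inner_elem {k : ℕ} (v w : Fin k → V) : ⟪elem v, elem w⟫ = ∏ i, ⟪v i, w i⟫ :=
  hsForm_tprod k v w

/-- The bilinear map `V^{⊗k} × V → V^{⊗(k+1)}`, `(x, v) ↦ x ⊗ v`. -/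
def tensorRightₗ (k : ℕ) : HSPower V k →ₗ[ℝ] V →ₗ[ℝ] HSPower V (k + 1) :=
  LinearMap.mk₂ ℝ
    (fun x v => toHS (k + 1) (TensorPower.mulEquiv
      ((toHS k).symm x ⊗ₜ[ℝ] (PiTensorProduct.subsingletonEquiv (0 : Fin 1)).symm v)))
    (fun x y v => by rw [map_add, TensorProduct.add_tmul, map_add, map_add])
    (fun c x v => by rw [map_smul, ← TensorProduct.smul_tmul', map_smul, map_smul])
    (fun x v w => by rw [map_add, TensorProduct.tmul_add, map_add, map_add])
    (fun c x v => by rw [map_smul, TensorProduct.tmul_smul, map_smul, map_smul])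

lemma tensorRightₗ_elem {k : ℕ} (w : Fin k → V) (v : V) :
    tensorRightₗ k (elem w) v = elem (Fin.snoc w v : Fin (k + 1) → V) := by
  have h := TensorPower.tprod_mul_tprod ℝ w (fun _ : Fin 1 => v)
  rw [TensorPower.gMul_def] at h
  have h1 : (PiTensorProduct.subsingletonEquiv (R := ℝ) (s := fun _ : Fin 1 => V) (0 : Fin 1)).symm v
      = PiTensorProduct.tprod ℝ (fun _ : Fin 1 => v) := by
    rw [LinearEquiv.symm_apply_eq, PiTensorProduct.subsingletonEquiv_apply_tprod]
  rw [tensorRightₗ, LinearMap.mk₂_apply, h1, elem, LinearEquiv.symm_apply_apply, h, elem,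
    Fin.append_right_eq_snoc]

/-- The map `(x, v) ↦ x ⊗ v` as a continuous bilinear map. -/
def tensorRight (k : ℕ) : HSPower V k →L[ℝ] V →L[ℝ] HSPower V (k + 1) :=
  LinearMap.toContinuousLinearMap
    ((LinearMap.toContinuousLinearMap (𝕜 := ℝ) (E := V) (F' := HSPower V (k + 1))).toLinearMap ∘ₗ
      tensorRightₗ k)

end Tensor

/-! ### Paths, signatures and unparameterised paths -/

/-- `C_{0,1}([a,b],V)`: continuous paths of bounded variation on `[a,b]` that start at `0`. -/
structure BVPath (V : Type u) [NormedAddCommGroup V] {a b : ℝ} (hab : a < b) where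
  toFun : Set.Icc a b → V
  continuous' : Continuous toFun
  boundedVariation' : BoundedVariationOn toFun Set.univ
  start_eq_zero' : toFun ⟨a, Set.left_mem_Icc.2 hab.le⟩ = 0

section Signature

variable {V : Type u} [NormedAddCommGroup V] {a b : ℝ} {hab : a < b}

/-- The path extended to `ℝ` by its end values; it is constant outside `[a,b]`. -/
def BVPath.extend (x : BVPath V hab) : ℝ → V := Set.IccExtend hab.le x.toFun

lemma BVPath.extend_boundedVariationOn (x : BVPath V hab) :
    BoundedVariationOn x.extend Set.univ :=
  ne_top_of_le_ne_top x.boundedVariation'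
    (eVariationOn.comp_le_of_monotoneOn _ _ ((Set.monotone_projIcc hab.le).monotoneOn _)
      (Set.mapsTo_univ _ _))

variable [InnerProductSpace ℝ V] [FiniteDimensional ℝ V]

/-- The Lebesgue-Stieltjes (vector) measure `dx` of a path. -/
def BVPath.dMeasure (x : BVPath V hab) : VectorMeasure ℝ V :=
  haveI : CompleteSpace V := FiniteDimensional.complete ℝ V
  x.extend_boundedVariationOn.vectorMeasure

/-- The iterated integrals
`S(x)^{(k)}_{[a,t]} = ∫_{a < t₁ < ⋯ < t_k < t} dx_{t₁} ⊗ ⋯ ⊗ dx_{t_k}`, through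
`S(x)^{(0)} = 1` and `S(x)^{(k+1)}_{[a,t]} = ∫_a^t S(x)^{(k)}_{[a,u]} ⊗ dx_u`. -/
def iteratedIntegral (x : BVPath V hab) : (k : ℕ) → ℝ → HSPower V k
  | 0, _ => elem Fin.elim0
  | k + 1, t =>
      (x.dMeasure.restrict (Set.Ioc a t)).integral (fun u => iteratedIntegral x k u) (tensorRight k)

/-- The signature transform `S(x) = (1, S(x)^{(1)}, S(x)^{(2)}, …) ∈ T((V)) = ∏_k V^{⊗k}`
over the whole interval `[a,b]`. -/
def signature (x : BVPath V hab) : (k : ℕ) → HSPower V k := fun k => iteratedIntegral x k b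

variable (V hab) in
/-- Two paths are equivalent if they have the same signature. -/
def sigSetoid : Setoid (BVPath V hab) := Setoid.ker signature

variable (V hab) in
/-- The space `𝒞` of unparameterised paths. -/
def UPath : Type u := Quotient (sigSetoid V hab)

/-- The signature of an unparameterised path. -/
def UPath.signature (x : UPath V hab) : (k : ℕ) → HSPower V k :=
  Quotient.lift (s := sigSetoid V hab) SigKernel.signature (fun _ _ h => h) x

end Signature

/-! ### The weighted tensor algebra and its completion -/

/-- The tensor algebra `T(V) = ⨁_k V^{⊗k}`, as the carrier of the `φ`-inner product. -/
def WTensor (V : Type u) [NormedAddCommGroup V] [InnerProductSpace ℝ V] [FiniteDimensional ℝ V]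
    (_φ : ℕ → ℝ≥0) : Type u :=
  Π₀ k : ℕ, HSPower V k

section Weighted

variable (V : Type u) [NormedAddCommGroup V] [InnerProductSpace ℝ V] [FiniteDimensional ℝ V]
  (φ : ℕ → ℝ≥0)

instance : AddCommGroup (WTensor V φ) := inferInstanceAs (AddCommGroup (Π₀ k : ℕ, HSPower V k))

instance : Module ℝ (WTensor V φ) := inferInstanceAs (Module ℝ (Π₀ k : ℕ, HSPower V k))

variable {V}

/-- The identity `⨁_k V^{⊗k} ≃ T(V)` as a linear equivalence. -/
def toW : (Π₀ k : ℕ, HSPower V k) ≃ₗ[ℝ] WTensor V φ := LinearEquiv.refl ℝ _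

/-- The component in `V^{⊗k}` of an element of `T(V)`. -/
def WTensor.comp (v : WTensor V φ) (k : ℕ) : HSPower V k := (toW φ).symm v k

lemma summable_weighted (v w : WTensor V φ) :
    Summable fun k => (φ k : ℝ) * ⟪v.comp φ k, w.comp φ k⟫ := by
  classical
  refine summable_of_ne_finset_zero (s := ((toW φ).symm v).support) fun k hk => ?_
  rw [WTensor.comp, DFinsupp.notMem_support_iff.1 hk]
  simp

/-- The `φ`-inner product `⟨v, w⟩_φ = ∑_k φ(k) ⟨v_k, w_k⟩` on `T(V)`. It is positive definite when
all `φ(k)` are positive, and positive semidefinite in general. -/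
instance wCore : PreInnerProductSpace.Core ℝ (WTensor V φ) where
  inner v w := ∑' k, (φ k : ℝ) * ⟪v.comp φ k, w.comp φ k⟫
  conj_inner_symm v w := by
    simp only [conj_trivial]
    exact tsum_congr fun k => by rw [real_inner_comm]
  re_inner_nonneg v := tsum_nonneg fun k => mul_nonneg (φ k).2 real_inner_self_nonneg
  add_left v w z := by
    rw [← (summable_weighted φ v z).tsum_add (summable_weighted φ w z)]
    refine tsum_congr fun k => ?_
    rw [← mul_add, ← inner_add_left]
    simp [WTensor.comp]
  smul_left v w r := by
    rw [← tsum_mul_left]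
    refine tsum_congr fun k => ?_
    have h : (r • v).comp φ k = r • v.comp φ k := by simp [WTensor.comp]
    rw [h, real_inner_smul_left, conj_trivial, mul_left_comm]

instance : SeminormedAddCommGroup (WTensor V φ) :=
  InnerProductSpace.Core.toSeminormedAddCommGroup (𝕜 := ℝ)

instance : InnerProductSpace ℝ (WTensor V φ) := InnerProductSpace.ofCore _

lemma inner_WTensor (v w : WTensor V φ) :
    ⟪v, w⟫ = ∑' k, (φ k : ℝ) * ⟪v.comp φ k, w.comp φ k⟫ := rfl

variable (V) in
/-- The Hilbert space `T_φ((V))`: the completion of `T(V)` for the `φ`-inner product. -/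
abbrev TPhi : Type u := UniformSpace.Completion (WTensor V φ)

/-- The homogeneous tensor `v ∈ V^{⊗k}` as an element of `T_φ((V))`. -/
def TPhi.level (k : ℕ) (v : HSPower V k) : TPhi V φ :=
  ((toW φ (DFinsupp.single k v) : WTensor V φ) : TPhi V φ)

/-- The element `∑_k v_k` of `T_φ((V))` given by a formal tensor series `(v_k) ∈ T((V))` for which
this series converges in `T_φ((V))`. -/
def TPhi.ofSeries (v : (k : ℕ) → HSPower V k) : TPhi V φ := ∑' k, TPhi.level φ k (v k)

variable {a b : ℝ} {hab : a < b}

/-- The `φ`-signature kernel `k_φ(x, y) = ⟨S(x), S(y)⟩_φ` on unparameterised paths. -/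
def sigKernel (x y : UPath V hab) : ℝ :=
  ⟪TPhi.ofSeries φ x.signature, TPhi.ofSeries φ y.signature⟫

variable (V hab) in
/-- The `φ`-signature kernel in the form of Mathlib's operator-valued kernels: the entries are
multiplication by `k_φ(x, y)` on `ℝ`. -/
def sigKernelMatrix : Matrix (UPath V hab) (UPath V hab) (ℝ →L[ℝ] ℝ) :=
  Matrix.of fun x y => sigKernel φ x y • (1 : ℝ →L[ℝ] ℝ)

instance : Fact (sigKernelMatrix V φ hab).PosSemidef := by
  have tfae := (RKHS.posSemidef_tfae (K := sigKernelMatrix V φ hab)).out 0 2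
  refine ⟨tfae.mpr ⟨?_, fun c => ?_⟩⟩
  · ext x y
    simp [sigKernelMatrix, sigKernel, real_inner_comm, Matrix.conjTranspose_apply, star_smul]
  · have : (c.sum fun x w => c.sum fun x' w' => ⟪sigKernelMatrix V φ hab x' x w, w'⟫) =
        ⟪(c.sum fun x w => w • TPhi.ofSeries φ x.signature : TPhi V φ),
          c.sum fun x w => w • TPhi.ofSeries φ x.signature⟫ := by
      simp only [Finsupp.sum, sum_inner, inner_sum, sigKernelMatrix, sigKernel, Matrix.of_apply]
      refine Finset.sum_congr rfl fun x _ => Finset.sum_congr rfl fun y _ => ?_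
      rw [real_inner_smul_left, real_inner_smul_right,
        real_inner_comm (TPhi.ofSeries φ x.signature)]
      simp only [smul_apply, one_apply_eq_self, smul_eq_mul,
        RCLike.inner_apply, conj_trivial]
      ring
    rw [this]
    exact real_inner_self_nonneg (F := TPhi V φ)

variable (V hab) in
/-- The RKHS `ℋ_φ` of the `φ`-signature kernel; its elements coerce to functions `𝒞 → ℝ`. -/
abbrev SigRKHS : Type u := RKHS.OfKernel (sigKernelMatrix V φ hab)

end Weighted

end SigKernel

end

noncomputable section

namespace SigKernel

open Set Filter Topology ENNReal

universe u

/-! ### Bounded variation and vector measures on the line -/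

/-! A feature map whose span is dense in a Hilbert space identifies that space isometrically with
the RKHS of its kernel (`exists_linearIsometryEquiv_rkhs`). What remains is convergence of the
signature series and density of the span of signatures in `TPhi V φ`.

Convergence comes from factorial decay: the `k`-th iterated integral is bounded by the volume of a
simplex for the variation measure of the path, which is `M ^ k / k!` because that measure has no
atoms (`simplexVolume_eq`, `norm_iteratedIntegral_le`).

For density, let `ℓ` be orthogonal to all signatures. Multiplying a path by `r` multiplies level `k`
of its signature by `r ^ k`, so `⟪ℓ, S(r x)⟫` is a power series in `r` that vanishes for every `r`;
hence `ℓ` is orthogonal to each level separately. For fixed `k` the `k`-th levels span `V^{⊗k}`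
(`span_range_iteratedIntegral`): if a path follows `x` up to time `s` and then moves with velocity
`c • v`, the derivative at `c = 0` of its level `k + 1` at time `t` is `(t - s) • S(x)^{(k)}_{[a,s]}
⊗ v`. This derivative lies in the span of level `k + 1`, which is closed because it is
finite-dimensional, and induction on `k` applies. So `ℓ` is orthogonal to every homogeneous tensor
and is zero. -/

lemma boundedVariationOn_add {α E : Type*} [LinearOrder α] [SeminormedAddCommGroup E]
    {f g : α → E} {s : Set α} (hf : BoundedVariationOn f s) (hg : BoundedVariationOn g s) :
    BoundedVariationOn (fun t => f t + g t) s := by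
  refine ne_top_of_le_ne_top (ENNReal.add_ne_top.2 ⟨hf, hg⟩) (iSup_le fun p => ?_)
  calc _ ≤ ∑ i ∈ Finset.range p.1, (edist (f (p.2.1 (i + 1))) (f (p.2.1 i)) +
        edist (g (p.2.1 (i + 1))) (g (p.2.1 i))) :=
        Finset.sum_le_sum fun i _ => edist_add_add_le _ _ _ _
    _ ≤ _ := by
        rw [Finset.sum_add_distrib]
        exact add_le_add (eVariationOn.sum_le p.2.2.1 p.2.2.2)
          (eVariationOn.sum_le p.2.2.1 p.2.2.2)

section VectorMeasure

variable {E : Type*} [NormedAddCommGroup E]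

lemma measurableSpace_eq_generateFrom_Ioc :
    (inferInstance : MeasurableSpace ℝ) =
      MeasurableSpace.generateFrom {s | ∃ u v : ℝ, u ≤ v ∧ s = Ioc u v} := by
  rw [BorelSpace.measurable_eq (α := ℝ)]
  convert! borel_eq_generateFrom_Ioc_le ℝ using 2
  grind only

/-- Half-open intervals form a generating π-system that does not contain the whole line; the total
mass is recovered by exhausting the line with `Ioc (-n) n`. -/
lemma vectorMeasure_ext_Ioc {μ ν : VectorMeasure ℝ E}
    (h : ∀ p q, p ≤ q → μ (Ioc p q) = ν (Ioc p q)) : μ = ν := by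
  refine VectorMeasure.ext_of_generateFrom _ ?_ measurableSpace_eq_generateFrom_Ioc
    IsSetSemiring.Ioc.isPiSystem ?_
  · rintro _ ⟨u, v, huv, rfl⟩
    exact h u v huv
  · have hU : (univ : Set ℝ) = ⋃ n : ℕ, Ioc (-(n : ℝ)) n := by
      refine (eq_univ_of_forall fun x => mem_iUnion.2 ?_).symm
      obtain ⟨n, hn⟩ := exists_nat_gt |x|
      exact ⟨n, (abs_lt.1 hn).1, (abs_lt.1 hn).2.le⟩
    have hm : Monotone fun n : ℕ => Ioc (-(n : ℝ)) n := fun i j hij =>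
      Ioc_subset_Ioc (by simpa using hij) (by simpa using hij)
    rw [hU]
    refine tendsto_nhds_unique (VectorMeasure.tendsto_vectorMeasure_iUnion_atTop_nat hm
      fun _ => measurableSet_Ioc) ?_
    simp_rw [h _ _ (neg_le_self (Nat.cast_nonneg _))]
    exact VectorMeasure.tendsto_vectorMeasure_iUnion_atTop_nat hm fun _ => measurableSet_Ioc

/-- The increments of `f` extend to some vector measure dominated by `m` on all measurable sets, and
uniqueness on intervals identifies it with `μ`. -/
lemma variation_le_of_Ioc [CompleteSpace E] {μ : VectorMeasure ℝ E} {m : Measure ℝ}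
    [IsFiniteMeasure m] {f : ℝ → E} (hμ : ∀ p q, p ≤ q → μ (Ioc p q) = f q - f p)
    (h : ∀ p q, p ≤ q → ‖f q - f p‖ₑ ≤ m (Ioc p q)) : μ.variation ≤ m := by
  obtain ⟨ν, hν, hνm⟩ :=
    VectorMeasure.exists_extension_of_isSetSemiring_of_le_measure_of_generateFrom (μ := m)
      (m := AddContent.onIoc f) IsSetSemiring.Ioc
      (by rintro _ ⟨u, v, huv, rfl⟩; rw [AddContent.onIoc_apply huv]; exact h u v huv)
      measurableSpace_eq_generateFrom_Ioc
  have : μ = ν := vectorMeasure_ext_Ioc fun p q hpq => by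
    rw [hμ p q hpq, hν _ ⟨p, q, hpq, rfl⟩, AddContent.onIoc_apply hpq]
  rw [this]
  exact VectorMeasure.variation_le_of_forall_enorm_le fun s _ => hνm s

/-- The dominating measure is the Stieltjes measure of the variation function of `f.rightLim`, which
is bounded by the total variation. -/
lemma isFiniteMeasure_variation_vectorMeasure [CompleteSpace E] {f : ℝ → E}
    (hf : BoundedVariationOn f univ) : IsFiniteMeasure hf.vectorMeasure.variation := by
  have : IsFiniteMeasure (hf.stieltjesFunctionRightLim 0).measure :=
    StieltjesFunction.isFiniteMeasure_of_forall_abs_le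
      (C := (eVariationOn f.rightLim univ).toReal) _
      (fun x => variationOnFromTo.abs_le_eVariationOn hf.rightLim)
  refine isFiniteMeasure_of_le _ (variation_le_of_Ioc (f := f.rightLim)
    (m := (hf.stieltjesFunctionRightLim 0).measure)
    (fun p q hpq => hf.vectorMeasure_Ioc hpq) fun u v huv => ?_)
  simp only [StieltjesFunction.measure_Ioc, BoundedVariationOn.stieltjesFunctionRightLim_apply]
  rw [← variationOnFromTo.add hf.rightLim.locallyBoundedVariationOn
    (mem_univ 0) (mem_univ u) (mem_univ v)]
  simp only [add_sub_cancel_left, variationOnFromTo, huv, ↓reduceIte, univ_inter]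
  rw [ENNReal.ofReal_toReal]
  · rw [← edist_eq_enorm_sub]
    exact eVariationOn.edist_le _ (by grind) (by grind)
  · exact ((eVariationOn.mono _ (subset_univ _)).trans_lt hf.rightLim.lt_top).ne

lemma nullSingletonClass_variation {μ : VectorMeasure ℝ E} (h : ∀ t, μ {t} = 0) :
    NullSingletonClass μ.variation where
  measure_singleton t := by
    rw [VectorMeasure.variation_apply_eq_zero (measurableSet_singleton t)]
    intro s hs _
    rcases subset_singleton_iff_eq.1 hs with rfl | rfl
    · simp
    · exact h t

end VectorMeasure

/-! ### Iterated integrals of an atomless measure -/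

/-- The volume of the simplex `{a < t₁ < ⋯ < t_k ≤ t}` for a measure on the line. -/
def simplexVolume (m : Measure ℝ) (a : ℝ) : ℕ → ℝ → ℝ≥0∞
  | 0, _ => 1
  | k + 1, t => ∫⁻ u in Ioc a t, simplexVolume m a k u ∂m

lemma simplexVolume_mono (m : Measure ℝ) (a : ℝ) : ∀ k, Monotone (simplexVolume m a k)
  | 0, _, _, _ => le_rfl
  | _ + 1, _, _, h => lintegral_mono_set (Ioc_subset_Ioc_right h)

lemma measurable_simplexVolume (m : Measure ℝ) (a : ℝ) (k : ℕ) :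
    Measurable (simplexVolume m a k) := (simplexVolume_mono m a k).measurable

/-- A free point added to `k` ordered points falls into one of `k + 1` gaps, each giving a copy of
the larger simplex. Ties are negligible because `m` has no atoms. -/
lemma measure_mul_simplexVolume (m : Measure ℝ) [IsFiniteMeasure m] [NullSingletonClass m]
    (a : ℝ) (k : ℕ) (t : ℝ) :
    m (Ioc a t) * simplexVolume m a k t = (k + 1) * simplexVolume m a (k + 1) t := by
  induction k generalizing t with
  | zero => simp [simplexVolume]
  | succ k ih =>
    set J := simplexVolume m a k
    have hJm : Measurable J := measurable_simplexVolume m a k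
    -- The simplex is cut according to whether its largest coordinate `u` lies before or after the
    -- free point `v`. Integrated over `v`, the first piece is the next simplex volume; the second
    -- becomes, by Tonelli, the induction hypothesis under an integral over `u`.
    have hsplit : ∀ v ∈ Ioc a t, simplexVolume m a (k + 1) t =
        simplexVolume m a (k + 1) v + ∫⁻ u in Ioc a t, (Ioc a u).indicator 1 v * J u ∂m := by
      intro v hv
      have h1 : simplexVolume m a (k + 1) v = ∫⁻ u in Ioo a v, J u ∂m :=
        (setLIntegral_congr Ioo_ae_eq_Ioc).symm
      have h2 : ∫⁻ u in Ioc a t, (Ioc a u).indicator 1 v * J u ∂m = ∫⁻ u in Icc v t, J u ∂m := by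
        rw [← lintegral_indicator measurableSet_Ioc, ← lintegral_indicator measurableSet_Icc]
        refine lintegral_congr fun u => ?_
        have := hv.1
        by_cases h : v ≤ u
        · by_cases h' : u ≤ t
          · have h'' : a < u := by linarith
            simp [indicator, h, h', h'', this]
          · simp [indicator, h, h']
        · simp [indicator, h]
      have h3 : Ioc a t = Ioo a v ∪ Icc v t := by
        rw [Ioo_union_Icc_eq_Ioc hv.1 hv.2]
      rw [h1, h2]
      change ∫⁻ u in Ioc a t, J u ∂m = _
      rw [h3, lintegral_union measurableSet_Icc]
      exact disjoint_left.2 fun u hu hu' => not_lt.2 hu'.1 hu.2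
    calc m (Ioc a t) * simplexVolume m a (k + 1) t
        = ∫⁻ _ in Ioc a t, simplexVolume m a (k + 1) t ∂m := by
          rw [setLIntegral_const, mul_comm]
      _ = ∫⁻ v in Ioc a t, (simplexVolume m a (k + 1) v +
            ∫⁻ u in Ioc a t, (Ioc a u).indicator 1 v * J u ∂m) ∂m :=
          setLIntegral_congr_fun measurableSet_Ioc hsplit
      _ = simplexVolume m a (k + 2) t +
            ∫⁻ v in Ioc a t, ∫⁻ u in Ioc a t, (Ioc a u).indicator 1 v * J u ∂m ∂m := by
          rw [lintegral_add_left (measurable_simplexVolume m a (k + 1))]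
          rfl
      _ = simplexVolume m a (k + 2) t + ∫⁻ u in Ioc a t, m (Ioc a u) * J u ∂m := by
          congr 1
          rw [lintegral_lintegral_swap]
          · refine setLIntegral_congr_fun measurableSet_Ioc fun u hu => ?_
            rw [lintegral_mul_const _ (measurable_one.indicator measurableSet_Ioc),
              lintegral_indicator_one measurableSet_Ioc, Measure.restrict_apply measurableSet_Ioc,
              inter_eq_left.2 (Ioc_subset_Ioc_right hu.2)]
          · refine (Measurable.mul ?_ (hJm.comp measurable_snd)).aemeasurable
            have : MeasurableSet {p : ℝ × ℝ | a < p.1 ∧ p.1 ≤ p.2} :=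
              (measurableSet_lt measurable_const measurable_fst).inter
                (measurableSet_le measurable_fst measurable_snd)
            exact measurable_one.indicator this
      _ = ((k + 1 : ℕ) + 1) * simplexVolume m a (k + 1 + 1) t := by
          simp_rw [ih]
          rw [lintegral_const_mul _ (measurable_simplexVolume m a (k + 1)), add_comm]
          change (k + 1 : ℝ≥0∞) * simplexVolume m a (k + 2) t + simplexVolume m a (k + 2) t = _
          push_cast
          ring

lemma simplexVolume_eq (m : Measure ℝ) [IsFiniteMeasure m] [NullSingletonClass m]
    (a : ℝ) (k : ℕ) (t : ℝ) :
    (k.factorial : ℝ≥0∞) * simplexVolume m a k t = m (Ioc a t) ^ k := by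
  induction k with
  | zero => simp [simplexVolume]
  | succ k ih =>
    rw [pow_succ, ← ih, Nat.factorial_succ, mul_assoc, mul_comm (simplexVolume m a k t),
      measure_mul_simplexVolume]
    push_cast
    ring

/-! ### Vanishing power series and Hilbert spaces of functions -/

/-- Convergence at `r = 1` gives radius at least `1`, and a power series representing the zero
function has zero coefficients. -/
lemma eq_zero_of_hasSum_mul_pow {c : ℕ → ℝ} (h : ∀ r : ℝ, HasSum (fun n => c n * r ^ n) 0)
    (n : ℕ) : c n = 0 := by
  have hp : HasFPowerSeriesOnBall (fun _ : ℝ => (0 : ℝ)) (FormalMultilinearSeries.ofScalars ℝ c)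
      0 1 := by
    refine ⟨?_, one_pos, fun {y} _ => ?_⟩
    · refine FormalMultilinearSeries.le_radius_of_tendsto (r := 1) _ (l := 0) ?_
      have := (h 1).summable.tendsto_atTop_zero.norm
      simpa [FormalMultilinearSeries.ofScalars_norm] using this
    · simpa [FormalMultilinearSeries.ofScalars_apply_eq, mul_comm] using h y
  have := hp.hasFPowerSeriesAt.eq_zero
  exact congrFun ((FormalMultilinearSeries.ofScalars_series_eq_zero ℝ).1 this) n

/-- A Hilbert space with a feature map of dense span is isometric to the reproducing kernel Hilbert
space of the kernel of the feature map. -/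
lemma exists_linearIsometryEquiv_rkhs {X T H : Type*} [NormedAddCommGroup T]
    [InnerProductSpace ℝ T] [CompleteSpace T] [NormedAddCommGroup H] [InnerProductSpace ℝ H]
    [CompleteSpace H] [RKHS ℝ H X ℝ] (Φ : X → T)
    (hΦ : (Submodule.span ℝ (range Φ)).topologicalClosure = ⊤)
    (hK : ∀ x y, RKHS.kernel H x y = ⟪Φ x, Φ y⟫ • (1 : ℝ →L[ℝ] ℝ)) :
    -- Both spaces are completions of the finitely supported functions on `X` for the same Gram
    -- form, so the identity extends to an isometry. It sends `Φ x` to the kernel function at `x`,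
    -- and the reproducing property gives the formula.
    ∃ Ψ : T ≃ₗᵢ[ℝ] H, ∀ (ℓ : T) (x : X), Ψ ℓ x = ⟪ℓ, Φ x⟫ := by
  let e₁ : (X →₀ ℝ) →ₗ[ℝ] T := Finsupp.linearCombination ℝ Φ
  let κ : X → H := fun x => RKHS.kerFun H x 1
  let e₂ : (X →₀ ℝ) →ₗ[ℝ] H := Finsupp.linearCombination ℝ κ
  have hκ : ∀ x y, ⟪κ x, κ y⟫ = ⟪Φ x, Φ y⟫ := fun x y => by
    have := RKHS.kernel_inner H y x (1 : ℝ) (1 : ℝ)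
    rw [hK] at this
    simpa [real_inner_comm, κ] using this.symm
  have hinner : ∀ c d, ⟪e₂ c, e₂ d⟫ = ⟪e₁ c, e₁ d⟫ := fun c d => by
    simp only [e₁, e₂, Finsupp.linearCombination_apply, Finsupp.sum, sum_inner, inner_sum,
      real_inner_smul_left, real_inner_smul_right, hκ]
  have hd₁ : DenseRange e₁ := by
    rw [DenseRange, ← LinearMap.coe_range, Submodule.dense_iff_topologicalClosure_eq_top]
    rw [Finsupp.range_linearCombination, hΦ]
  have hd₂ : DenseRange e₂ := by
    rw [DenseRange, ← LinearMap.coe_range, Submodule.dense_iff_topologicalClosure_eq_top]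
    rw [Finsupp.range_linearCombination, eq_top_iff, ← RKHS.kerFun_dense (H := H)]
    refine Submodule.topologicalClosure_mono (Submodule.span_le.2 ?_)
    rintro _ ⟨x, v, rfl⟩
    have : RKHS.kerFun H x v = v • κ x := by
      rw [← map_smul, smul_eq_mul, mul_one]
    rw [this]
    exact Submodule.smul_mem _ _ (Submodule.subset_span ⟨x, rfl⟩)
  have hnorm : ∀ c, ‖e₂ (LinearEquiv.refl ℝ _ c)‖ = ‖e₁ c‖ := fun c => by
    rw [LinearEquiv.refl_apply, norm_eq_sqrt_real_inner, norm_eq_sqrt_real_inner, hinner]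
  let Ψ : T ≃ₗᵢ[ℝ] H := (LinearEquiv.refl ℝ (X →₀ ℝ)).extendOfIsometry e₁ e₂ hd₁ hd₂ hnorm
  have hΨ : ∀ x, Ψ (Φ x) = κ x := fun x => by
    have := LinearEquiv.extendOfIsometry_eq (LinearEquiv.refl ℝ (X →₀ ℝ)) e₁ e₂ hd₁ hd₂ hnorm
      (Finsupp.single x 1)
    simpa [e₁, e₂] using this
  refine ⟨Ψ, fun ℓ x => ?_⟩
  rw [← Ψ.inner_map_map, hΨ]
  simp [κ]

/-! ### Bounds for integrals against a vector measure -/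

section Integral

variable {E F G : Type*} [NormedAddCommGroup E] [NormedSpace ℝ E] [NormedAddCommGroup F]
  [NormedSpace ℝ F] [NormedAddCommGroup G] [NormedSpace ℝ G] {μ : VectorMeasure ℝ F}
  {B : E →L[ℝ] F →L[ℝ] G} {f : ℝ → E} {s : Set ℝ}

lemma enorm_setIntegral_le_lintegral (hB : ∀ x y, ‖B x y‖ ≤ ‖x‖ * ‖y‖) :
    ‖(μ.restrict s).integral f B‖ₑ ≤ ∫⁻ x in s, ‖f x‖ₑ ∂μ.variation := by
  have h1 : ‖B‖ₑ ≤ 1 := by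
    rw [← ofReal_norm, ← ENNReal.ofReal_one]
    exact ENNReal.ofReal_le_ofReal
      (B.opNorm_le_bound₂ zero_le_one fun x y => by rw [one_mul]; exact hB x y)
  grw [VectorMeasure.enorm_setIntegral_le_lintegral_enorm, h1, one_mul]

lemma norm_setIntegral_le_of_bound [IsFiniteMeasure μ.variation]
    (hB : ∀ x y, ‖B x y‖ ≤ ‖x‖ * ‖y‖) {C : ℝ} (hC : 0 ≤ C) (hf : ∀ x ∈ s, ‖f x‖ ≤ C) :
    ‖(μ.restrict s).integral f B‖ ≤ C * μ.variation.real s := by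
  refine (VectorMeasure.norm_setIntegral_le_of_norm_le_const hf).trans ?_
  refine mul_le_mul_of_nonneg_right (mul_le_of_le_one_right hC ?_) measureReal_nonneg
  exact B.opNorm_le_bound₂ zero_le_one fun x y => by rw [one_mul]; exact hB x y

end Integral

/-! ### Multiplicativity of the Hilbert–Schmidt norm -/

section Tensor

variable {V : Type u} [NormedAddCommGroup V] [InnerProductSpace ℝ V]

lemma span_range_elem (k : ℕ) :
    Submodule.span ℝ (range (elem : (Fin k → V) → HSPower V k)) = ⊤ := by
  have h := PiTensorProduct.span_tprod_eq_top (R := ℝ) (s := fun _ : Fin k => V)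
  have h2 := congrArg (Submodule.map (toHS (V := V) k).toLinearMap) h
  rw [Submodule.map_span, Submodule.map_top, LinearEquiv.range, ← range_comp] at h2
  exact h2

variable [FiniteDimensional ℝ V]

lemma tensorRight_elem {k : ℕ} (w : Fin k → V) (v : V) :
    tensorRight k (elem w) v = elem (Fin.snoc w v : Fin (k + 1) → V) :=
  tensorRightₗ_elem w v

lemma inner_tensorRight (k : ℕ) (x y : HSPower V k) (v w : V) :
    ⟪tensorRight k x v, tensorRight k y w⟫ = ⟪x, y⟫ * ⟪v, w⟫ := by
  have hx : x ∈ Submodule.span ℝ (range (elem : (Fin k → V) → HSPower V k)) := by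
    rw [span_range_elem]; trivial
  have hy : y ∈ Submodule.span ℝ (range (elem : (Fin k → V) → HSPower V k)) := by
    rw [span_range_elem]; trivial
  induction hx using Submodule.span_induction with
  | zero => simp
  | add x₁ x₂ _ _ h₁ h₂ => rw [map_add, add_apply, inner_add_left, h₁, h₂, inner_add_left, add_mul]
  | smul c x _ h =>
    rw [map_smul, smul_apply, real_inner_smul_left, h, real_inner_smul_left, mul_assoc]
  | mem x hx =>
    obtain ⟨p, rfl⟩ := hx
    induction hy using Submodule.span_induction with
    | zero => simp
    | add x₁ x₂ _ _ h₁ h₂ =>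
      rw [map_add, add_apply, inner_add_right, h₁, h₂, inner_add_right, add_mul]
    | smul c x _ h =>
      rw [map_smul, smul_apply, real_inner_smul_right, h, real_inner_smul_right, mul_assoc]
    | mem y hy =>
      obtain ⟨q, rfl⟩ := hy
      rw [tensorRight_elem, tensorRight_elem, inner_elem, inner_elem, Fin.prod_univ_castSucc]
      simp

/-- Constant `1` here keeps the iterated estimates free of factors depending on `k`. -/
lemma norm_tensorRight_apply (k : ℕ) (x : HSPower V k) (v : V) :
    ‖tensorRight k x v‖ = ‖x‖ * ‖v‖ := by
  rw [← sq_eq_sq₀ (norm_nonneg _) (by positivity), mul_pow, ← real_inner_self_eq_norm_sq,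
    ← real_inner_self_eq_norm_sq, ← real_inner_self_eq_norm_sq, inner_tensorRight]

end Tensor

/-! ### Operations on paths and their Stieltjes measures -/

section Path

variable {V : Type u} [NormedAddCommGroup V] {a b : ℝ} {hab : a < b}

lemma BVPath.continuous_extend (x : BVPath V hab) : Continuous x.extend :=
  x.continuous'.Icc_extend'

/-- The Stieltjes measure is expressed through one-sided limits; continuity turns them into values,
so intervals carry plain increments and points carry no mass. -/
lemma BVPath.rightLim_extend (x : BVPath V hab) (t : ℝ) :
    Function.rightLim x.extend t = x.extend t :=
  rightLim_eq_of_tendsto (x.continuous_extend.tendsto t |>.mono_left nhdsWithin_le_nhds)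

lemma BVPath.leftLim_extend (x : BVPath V hab) (t : ℝ) :
    Function.leftLim x.extend t = x.extend t :=
  leftLim_eq_of_tendsto (x.continuous_extend.tendsto t |>.mono_left nhdsWithin_le_nhds)

/-- The pointwise sum of two paths. -/
def BVPath.add (x y : BVPath V hab) : BVPath V hab where
  toFun t := x.toFun t + y.toFun t
  continuous' := x.continuous'.add y.continuous'
  boundedVariation' := boundedVariationOn_add x.boundedVariation' y.boundedVariation'
  start_eq_zero' := by rw [x.start_eq_zero', y.start_eq_zero', add_zero]

lemma BVPath.extend_add (x y : BVPath V hab) (t : ℝ) :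
    (x.add y).extend t = x.extend t + y.extend t := rfl

/-- The path that is constant from time `s` on. -/
def BVPath.frozenAt (x : BVPath V hab) (s : ℝ) : BVPath V hab where
  toFun t := x.extend (min t s)
  continuous' := x.continuous_extend.comp (continuous_subtype_val.min continuous_const)
  boundedVariation' := ne_top_of_le_ne_top x.extend_boundedVariationOn
    (eVariationOn.comp_le_of_monotoneOn _ _
      ((Subtype.mono_coe _).min monotone_const |>.monotoneOn _) (mapsTo_univ _ _))
  start_eq_zero' := by
    rw [BVPath.extend, IccExtend_of_le_left _ _ (min_le_left _ _), x.start_eq_zero']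

lemma BVPath.extend_frozenAt (x : BVPath V hab) {s t : ℝ} (hs : s ∈ Icc a b) :
    (x.frozenAt s).extend t = x.extend (min t s) := by
  change x.extend (min (max a (min b t)) s) = _
  rcases le_total t a with h | h
  · have h1 : min (max a (min b t)) s = a := by
      rw [min_eq_right (h.trans hab.le), max_eq_left h, min_eq_left hs.1]
    rw [h1, min_eq_left (h.trans hs.1), BVPath.extend, IccExtend_of_le_left _ _ le_rfl,
      IccExtend_of_le_left _ _ h]
  · congr 1
    rw [max_eq_right (le_min hab.le h), min_right_comm, min_eq_right hs.2, min_comm]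

variable [InnerProductSpace ℝ V]

/-- The pointwise multiple of a path. -/
def BVPath.smul (c : ℝ) (x : BVPath V hab) : BVPath V hab where
  toFun t := c • x.toFun t
  continuous' := x.continuous'.const_smul c
  boundedVariation' := (lipschitzWith_smul c).comp_boundedVariationOn x.boundedVariation'
  start_eq_zero' := by rw [x.start_eq_zero', smul_zero]

variable (hab) in
/-- The path that rests until time `s ≥ a` and then has constant velocity `v`. -/
def BVPath.ramp {s : ℝ} (hs : a ≤ s) (v : V) : BVPath V hab where
  toFun t := max ((t : ℝ) - s) 0 • v
  continuous' := by fun_prop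
  boundedVariation' := by
    have h : BoundedVariationOn (fun t : Icc a b => max ((t : ℝ) - s) 0) univ := by
      refine MonotoneOn.boundedVariationOn (C := b - a) (Monotone.monotoneOn ?_ _) fun t _ => ?_
      · exact fun t t' h => max_le_max_right 0 (sub_le_sub_right (Subtype.coe_le_coe.2 h) s)
      · rw [abs_of_nonneg (le_max_right _ _)]
        exact max_le (by linarith [t.2.2]) (by linarith)
    have hl : LipschitzWith ‖v‖₊ fun r : ℝ => r • v :=
      LipschitzWith.of_dist_le_mul fun r r' => by
        rw [dist_eq_norm, ← sub_smul, norm_smul, dist_eq_norm, mul_comm, coe_nnnorm]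
    exact hl.comp_boundedVariationOn h
  start_eq_zero' := by simp [hs]

lemma BVPath.extend_smul (c : ℝ) (x : BVPath V hab) (t : ℝ) :
    (x.smul c).extend t = c • x.extend t := rfl

lemma BVPath.extend_ramp {s t : ℝ} (hs : a ≤ s) (v : V) (ht : t ≤ b) :
    (BVPath.ramp hab hs v).extend t = max (t - s) 0 • v := by
  change max (max a (min b t) - s) 0 • v = max (t - s) 0 • v
  rw [min_eq_right ht]
  rcases le_total t a with h | h
  · rw [max_eq_left h, max_eq_right (by linarith), max_eq_right (by linarith)]
  · rw [max_eq_right h]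

/-- The path that follows `x` until time `s` and then moves with constant velocity `c • v`. -/
def BVPath.prolong (x : BVPath V hab) {s : ℝ} (hs : a ≤ s) (v : V) (c : ℝ) : BVPath V hab :=
  (x.frozenAt s).add ((BVPath.ramp hab hs v).smul c)

lemma BVPath.extend_prolong (x : BVPath V hab) {s t : ℝ} (hs : s ∈ Icc a b) (v : V) (c : ℝ) :
    (x.prolong hs.1 v c).extend t =
      x.extend (min t s) + c • (BVPath.ramp hab hs.1 v).extend t := by
  rw [BVPath.prolong, BVPath.extend_add, BVPath.extend_frozenAt x hs, BVPath.extend_smul]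

variable [FiniteDimensional ℝ V]

lemma BVPath.dMeasure_Ioc (x : BVPath V hab) {p q : ℝ} (h : p ≤ q) :
    x.dMeasure (Ioc p q) = x.extend q - x.extend p := by
  have : CompleteSpace V := FiniteDimensional.complete ℝ V
  rw [BVPath.dMeasure, x.extend_boundedVariationOn.vectorMeasure_Ioc h,
    x.rightLim_extend, x.rightLim_extend]

instance (x : BVPath V hab) : IsFiniteMeasure x.dMeasure.variation :=
  have : CompleteSpace V := FiniteDimensional.complete ℝ V
  isFiniteMeasure_variation_vectorMeasure x.extend_boundedVariationOn

instance (x : BVPath V hab) : NullSingletonClass x.dMeasure.variation :=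
  have : CompleteSpace V := FiniteDimensional.complete ℝ V
  nullSingletonClass_variation fun t => by
    rw [BVPath.dMeasure, x.extend_boundedVariationOn.vectorMeasure_singleton,
      x.rightLim_extend, x.leftLim_extend,
      sub_self]

lemma BVPath.dMeasure_add (x y : BVPath V hab) :
    (x.add y).dMeasure = x.dMeasure + y.dMeasure :=
  vectorMeasure_ext_Ioc fun p q h => by
    simp only [add_apply, BVPath.dMeasure_Ioc _ h, BVPath.extend_add]
    abel

lemma BVPath.dMeasure_smul (c : ℝ) (x : BVPath V hab) :
    (x.smul c).dMeasure = c • x.dMeasure :=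
  vectorMeasure_ext_Ioc fun p q h => by
    simp only [smul_apply, BVPath.dMeasure_Ioc _ h, BVPath.extend_smul, smul_sub]

lemma BVPath.dMeasure_restrict_eq {z y : BVPath V hab} {c p q : ℝ}
    (h : ∀ u v, p ≤ u → u ≤ v → v ≤ q →
      z.extend v - z.extend u = c • (y.extend v - y.extend u)) :
    z.dMeasure.restrict (Ioc p q) = c • y.dMeasure.restrict (Ioc p q) :=
  vectorMeasure_ext_Ioc fun r s _ => by
    rw [smul_apply, VectorMeasure.restrict_apply _ measurableSet_Ioc measurableSet_Ioc,
      VectorMeasure.restrict_apply _ measurableSet_Ioc measurableSet_Ioc, Ioc_inter_Ioc]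
    rcases le_total (r ⊔ p) (s ⊓ q) with hle | hle
    · rw [z.dMeasure_Ioc hle, y.dMeasure_Ioc hle]
      exact h _ _ le_sup_right hle inf_le_right
    · rw [Ioc_eq_empty (not_lt.2 hle)]
      simp

/-! ### Estimates for iterated integrals -/

lemma enorm_iteratedIntegral_le (x : BVPath V hab) (k : ℕ) (t : ℝ) :
    ‖iteratedIntegral x k t‖ₑ ≤ simplexVolume x.dMeasure.variation a k t := by
  induction k generalizing t with
  | zero =>
    have : ‖(elem Fin.elim0 : HSPower V 0)‖ ^ 2 = 1 := by
      rw [← real_inner_self_eq_norm_sq, inner_elem]; simp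
    have h1 : ‖(elem Fin.elim0 : HSPower V 0)‖ = 1 := by
      exact (pow_eq_one_iff_of_nonneg (norm_nonneg _) two_ne_zero).1 this
    rw [iteratedIntegral, simplexVolume, ← ofReal_norm, h1, ENNReal.ofReal_one]
  | succ k ih =>
    rw [iteratedIntegral, simplexVolume]
    exact (enorm_setIntegral_le_lintegral fun x v => (norm_tensorRight_apply k x v).le).trans
      (lintegral_mono fun u => ih u)

lemma norm_iteratedIntegral_le (x : BVPath V hab) (k : ℕ) (t : ℝ) :
    ‖iteratedIntegral x k t‖ ≤ x.dMeasure.variation.real univ ^ k / k.factorial := by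
  have hk : (0 : ℝ) < k.factorial := by positivity
  rw [le_div_iff₀ hk, ← ENNReal.ofReal_le_ofReal_iff (by positivity), mul_comm,
    ENNReal.ofReal_mul hk.le, ENNReal.ofReal_natCast, ofReal_norm,
    ENNReal.ofReal_pow measureReal_nonneg, ofReal_measureReal]
  calc _ ≤ (k.factorial : ℝ≥0∞) * simplexVolume x.dMeasure.variation a k t := by
        gcongr; exact enorm_iteratedIntegral_le x k t
    _ = x.dMeasure.variation (Ioc a t) ^ k := simplexVolume_eq _ _ _ _
    _ ≤ _ := by gcongr; exact subset_univ _

lemma norm_iteratedIntegral_le_pow (x : BVPath V hab) (k : ℕ) (t : ℝ) :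
    ‖iteratedIntegral x k t‖ ≤ x.dMeasure.variation.real univ ^ k :=
  (norm_iteratedIntegral_le x k t).trans
    (div_le_self (by positivity) (by exact_mod_cast k.factorial_pos))

lemma integrable_of_continuous_of_bound {E : Type*} [NormedAddCommGroup E]
    {m : Measure ℝ} [IsFiniteMeasure m] {f : ℝ → E} (hf : Continuous f) {C : ℝ}
    (hC : ∀ t, ‖f t‖ ≤ C) : Integrable f m :=
  Integrable.of_bound hf.aestronglyMeasurable C (Eventually.of_forall hC)

/-- Continuity makes each iterated integral integrable against the measure of any path, which the
later splitting and linearity of integrals require. -/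
lemma continuous_iteratedIntegral (x : BVPath V hab) (k : ℕ) :
    Continuous (iteratedIntegral x k) := by
  induction k with
  | zero => exact continuous_const
  | succ k ih =>
    set m := x.dMeasure.variation with hm
    have hint : x.dMeasure.Integrable (iteratedIntegral x k) :=
      integrable_of_continuous_of_bound ih (norm_iteratedIntegral_le_pow x k)
    -- `W` is a distribution function of the variation measure. It is continuous because there are
    -- no atoms, and it controls the increments of the next iterated integral.
    let W : ℝ → ℝ := fun t => ∫ _ in (0 : ℝ)..t, (1 : ℝ) ∂m
    have hW : Continuous W :=
      intervalIntegral.continuous_primitive (fun _ _ => intervalIntegrable_const) 0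
    set C := m.real univ ^ k with hC
    have key : ∀ p q, p ≤ q → ‖iteratedIntegral x (k + 1) q - iteratedIntegral x (k + 1) p‖ ≤
        C * |W q - W p| := by
      intro p q hpq
      have h1 : W q - W p = m.real (Ioc p q) := by
        simp only [W]
        rw [intervalIntegral.integral_interval_sub_left intervalIntegrable_const
          intervalIntegrable_const, intervalIntegral.integral_of_le hpq]
        simp
      rw [iteratedIntegral, iteratedIntegral, ← VectorMeasure.setIntegral_sdiff measurableSet_Ioc
        measurableSet_Ioc hint.integrableOn (Ioc_subset_Ioc_right hpq), h1,
        abs_of_nonneg measureReal_nonneg]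
      refine (norm_setIntegral_le_of_bound (fun x v => (norm_tensorRight_apply k x v).le)
        (by positivity) fun u _ => norm_iteratedIntegral_le_pow x k u).trans ?_
      refine mul_le_mul_of_nonneg_left (measureReal_mono ?_) (by positivity)
      rintro u ⟨hu, hu'⟩
      exact ⟨by by_contra h; exact hu' ⟨hu.1, not_lt.1 h⟩, hu.2⟩
    have key' : ∀ p q, ‖iteratedIntegral x (k + 1) q - iteratedIntegral x (k + 1) p‖ ≤
        C * |W q - W p| := by
      intro p q
      rcases le_total p q with h | h
      · exact key p q h
      · rw [norm_sub_rev, abs_sub_comm]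
        exact key q p h
    refine continuous_iff_continuousAt.2 fun p => ?_
    rw [ContinuousAt, tendsto_iff_norm_sub_tendsto_zero]
    refine squeeze_zero (fun _ => norm_nonneg _) (fun q => key' p q) ?_
    have : Continuous fun q => C * |W q - W p| := by fun_prop
    simpa using this.tendsto p

lemma integrable_iteratedIntegral (x y : BVPath V hab) (k : ℕ) :
    y.dMeasure.Integrable (iteratedIntegral x k) :=
  integrable_of_continuous_of_bound (continuous_iteratedIntegral x k)
    (norm_iteratedIntegral_le_pow x k)

/-- Two uses: `c = 1` shows that only the path up to time `s` matters, and `s = b` gives the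
homogeneity of the signature. -/
lemma iteratedIntegral_eq_smul {z x : BVPath V hab} {c s : ℝ}
    (h : ∀ u v, a ≤ u → u ≤ v → v ≤ s →
      z.extend v - z.extend u = c • (x.extend v - x.extend u)) (k : ℕ) :
    ∀ t ≤ s, iteratedIntegral z k t = c ^ k • iteratedIntegral x k t := by
  induction k with
  | zero => intro t _; simp [iteratedIntegral]
  | succ k ih =>
    intro t ht
    rw [iteratedIntegral, iteratedIntegral,
      VectorMeasure.setIntegral_congr_fun (g := fun u => c ^ k • iteratedIntegral x k u)
        fun u hu => ih u (hu.2.trans ht),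
      BVPath.dMeasure_restrict_eq fun u v hu huv hv => h u v hu huv (hv.trans ht),
      VectorMeasure.integral_smul_vectorMeasure, VectorMeasure.integral_fun_smul, smul_smul,
      pow_succ']

lemma signature_smul (c : ℝ) (x : BVPath V hab) (k : ℕ) :
    signature (x.smul c) k = c ^ k • signature x k :=
  iteratedIntegral_eq_smul (s := b)
    (fun u v _ _ _ => by simp only [BVPath.extend_smul, smul_sub]) k b le_rfl

end Path

/-! ### The levels of signatures span the tensor powers -/

section Span

variable {V : Type u} [NormedAddCommGroup V] [InnerProductSpace ℝ V] [FiniteDimensional ℝ V]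
  {a b : ℝ} {hab : a < b}

lemma iteratedIntegral_prolong_of_le (x : BVPath V hab) {s t : ℝ} (hs : s ∈ Icc a b) (v : V)
    (c : ℝ) (k : ℕ) (ht : t ≤ s) :
    iteratedIntegral (x.prolong hs.1 v c) k t = iteratedIntegral x k t := by
  have h : ∀ u ≤ s, (x.prolong hs.1 v c).extend u = x.extend u := fun u hu => by
    rw [BVPath.extend_prolong x hs, min_eq_left hu, BVPath.extend_ramp hs.1 v (hu.trans hs.2),
      max_eq_right (by linarith), zero_smul, smul_zero, add_zero]
  have := iteratedIntegral_eq_smul (z := x.prolong hs.1 v c) (x := x) (c := 1) (s := s)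
    (fun p q _ hpq hq => by rw [h p (hpq.trans hq), h q hq, one_smul]) k t ht
  rwa [one_pow, one_smul] at this

/-- The integral is split at `s`; after `s` the frozen path has no increments, so only `c` times the
measure of the ramp remains. The integrand still depends on `c`. -/
lemma iteratedIntegral_prolong_succ (x : BVPath V hab) {s t : ℝ} (hs : s ∈ Icc a b) (v : V)
    (c : ℝ) (k : ℕ) (ht : s ≤ t) :
    iteratedIntegral (x.prolong hs.1 v c) (k + 1) t = iteratedIntegral x (k + 1) s +
      c • ((BVPath.ramp hab hs.1 v).dMeasure.restrict (Ioc s t)).integral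
        (fun u => iteratedIntegral (x.prolong hs.1 v c) k u) (tensorRight k) := by
  set z := x.prolong hs.1 v c with hz
  have hint := (integrable_iteratedIntegral z z k)
  have h1 : z.dMeasure.restrict (Ioc s t) =
      c • (BVPath.ramp hab hs.1 v).dMeasure.restrict (Ioc s t) :=
    BVPath.dMeasure_restrict_eq fun p q hp hpq hq => by
      rw [hz, BVPath.extend_prolong x hs, BVPath.extend_prolong x hs,
        min_eq_right hp, min_eq_right (hp.trans hpq), smul_sub]
      abel
  rw [← iteratedIntegral_prolong_of_le x hs v c (k + 1) le_rfl, ← hz, iteratedIntegral,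
    iteratedIntegral, ← VectorMeasure.integral_smul_vectorMeasure, ← h1,
    ← VectorMeasure.setIntegral_union _ measurableSet_Ioc measurableSet_Ioc hint.integrableOn
      hint.integrableOn, Ioc_union_Ioc_eq_Ioc hs.1 ht]
  exact Ioc_disjoint_Ioc_of_le le_rfl

lemma exists_norm_iteratedIntegral_prolong_le (x : BVPath V hab) {s : ℝ} (hs : a ≤ s) (v : V)
    (k : ℕ) : ∃ C, 0 ≤ C ∧ ∀ c : ℝ, |c| ≤ 1 → ∀ t,
      ‖iteratedIntegral (x.prolong hs v c) k t‖ ≤ C := by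
  set M := (x.frozenAt s).dMeasure.variation.real univ +
    (BVPath.ramp hab hs v).dMeasure.variation.real univ with hM
  refine ⟨M ^ k, by positivity, fun c hc t => (norm_iteratedIntegral_le_pow _ k t).trans ?_⟩
  refine pow_le_pow_left₀ measureReal_nonneg ?_ k
  rw [BVPath.prolong, BVPath.dMeasure_add, BVPath.dMeasure_smul]
  have h1 : ((x.frozenAt s).dMeasure + c • (BVPath.ramp hab hs v).dMeasure).variation ≤
      (x.frozenAt s).dMeasure.variation + (BVPath.ramp hab hs v).dMeasure.variation := by
    refine VectorMeasure.variation_add_le.trans ?_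
    rw [VectorMeasure.variation_smul]
    refine add_le_add le_rfl (Measure.le_iff.2 fun S _ => ?_)
    rw [Measure.smul_apply]
    have : ‖c‖₊ ≤ 1 := by rw [← NNReal.coe_le_coe]; simpa using hc
    calc ‖c‖₊ • (BVPath.ramp hab hs v).dMeasure.variation S
        ≤ (1 : ℝ≥0) • (BVPath.ramp hab hs v).dMeasure.variation S := by gcongr
      _ = _ := one_smul _ _
  rw [hM, ← measureReal_add_apply]
  exact ENNReal.toReal_mono (measure_ne_top _ _) (h1 univ)

/-- The limit is the derivative in `c` at `0` of level `k + 1` at time `t`. -/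
lemma tendsto_iteratedIntegral_prolong (x : BVPath V hab) {s t : ℝ} (hs : s ∈ Icc a b)
    (ht : t ∈ Icc s b) (v : V) (k : ℕ) :
    Tendsto (fun c => ((BVPath.ramp hab hs.1 v).dMeasure.restrict (Ioc s t)).integral
        (fun u => iteratedIntegral (x.prolong hs.1 v c) k u) (tensorRight k)) (𝓝 0)
      (𝓝 (tensorRight k (iteratedIntegral x k s) ((t - s) • v))) := by
  set y := BVPath.ramp hab hs.1 v with hy
  set m := y.dMeasure.variation with hm
  -- The integrand tends uniformly to its value at time `s`. Level `0` is constant; at a positive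
  -- level the splitting formula pulls out a factor `c`.
  obtain ⟨D, hD, hbound⟩ : ∃ D, 0 ≤ D ∧ ∀ c : ℝ, |c| ≤ 1 → ∀ u ∈ Ioc s t,
      ‖iteratedIntegral (x.prolong hs.1 v c) k u - iteratedIntegral x k s‖ ≤ |c| * D := by
    cases k with
    | zero => exact ⟨0, le_rfl, fun c _ u _ => by simp [iteratedIntegral]⟩
    | succ j =>
      obtain ⟨C, hC, hCb⟩ := exists_norm_iteratedIntegral_prolong_le x hs.1 v j
      refine ⟨C * m.real univ, by positivity, fun c hc u hu => ?_⟩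
      rw [iteratedIntegral_prolong_succ x hs v c j hu.1.le, add_sub_cancel_left, norm_smul,
        Real.norm_eq_abs]
      refine mul_le_mul_of_nonneg_left ?_ (abs_nonneg c)
      refine (norm_setIntegral_le_of_bound (fun x v => (norm_tensorRight_apply j x v).le) hC
        fun r _ => hCb c hc r).trans ?_
      exact mul_le_mul_of_nonneg_left (measureReal_mono (subset_univ _)) hC
  have hconst : tensorRight k (iteratedIntegral x k s) ((t - s) • v) =
      (y.dMeasure.restrict (Ioc s t)).integral (fun _ => iteratedIntegral x k s)
        (tensorRight k) := by
    rw [VectorMeasure.setIntegral_const, y.dMeasure_Ioc ht.1, hy,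
      BVPath.extend_ramp hs.1 v ht.2, BVPath.extend_ramp hs.1 v hs.2, sub_self, max_self,
      zero_smul, sub_zero, max_eq_left (sub_nonneg.2 ht.1)]
  rw [tendsto_iff_norm_sub_tendsto_zero]
  have hlim : Tendsto (fun c : ℝ => |c| * D * m.real (Ioc s t)) (𝓝 0) (𝓝 0) := by
    have : Continuous fun c : ℝ => |c| * D * m.real (Ioc s t) := by fun_prop
    simpa using this.tendsto 0
  refine squeeze_zero' (Eventually.of_forall fun _ => norm_nonneg _) ?_ hlim
  have h1 : ∀ᶠ c : ℝ in 𝓝 0, |c| < 1 := by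
    have : Continuous fun c : ℝ => |c| := continuous_abs
    exact this.continuousAt.eventually_lt continuousAt_const (by simp)
  filter_upwards [h1] with c hc
  rw [hconst, ← VectorMeasure.integral_fun_sub (integrable_iteratedIntegral _ y k).integrableOn
    (integrable_const _)]
  exact norm_setIntegral_le_of_bound (fun x v => (norm_tensorRight_apply k x v).le)
    (by positivity) (hbound c hc.le)

theorem span_range_iteratedIntegral (k : ℕ) : ∀ t ∈ Ioc a b,
    Submodule.span ℝ (range fun x : BVPath V hab => iteratedIntegral x k t) = ⊤ := by
  induction k with
  | zero =>
    intro t _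
    rw [eq_top_iff, ← span_range_elem 0]
    refine Submodule.span_mono ?_
    rintro _ ⟨w, rfl⟩
    exact ⟨BVPath.ramp hab le_rfl 0, congrArg elem (Subsingleton.elim _ _)⟩
  | succ k ih =>
    intro t ht
    set W := Submodule.span ℝ (range fun x : BVPath V hab => iteratedIntegral x (k + 1) t) with hW
    -- The time after `s` is reserved for the linear piece. The induction hypothesis is needed at
    -- `s` rather than `t`, hence a statement for all times in `Ioc a b`.
    obtain ⟨s, has, hst⟩ := exists_between ht.1
    have hs : s ∈ Icc a b := ⟨has.le, hst.le.trans ht.2⟩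
    have hmem : ∀ x v, tensorRight k (iteratedIntegral (x : BVPath V hab) k s) v ∈ W := by
      intro x v
      set I : ℝ → HSPower V (k + 1) := fun c =>
        ((BVPath.ramp hab hs.1 v).dMeasure.restrict (Ioc s t)).integral
          (fun u => iteratedIntegral (x.prolong hs.1 v c) k u) (tensorRight k) with hI
      have hS : ∀ c, iteratedIntegral x (k + 1) s + c • I c ∈ W := fun c => by
        rw [← iteratedIntegral_prolong_succ x hs v c k hst.le]
        exact Submodule.subset_span ⟨_, rfl⟩
      -- `I c` is the difference quotient between the prolongations with parameters `c` and `0`.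
      have hIc : ∀ c ≠ 0, I c ∈ W := fun c hc => by
        have := W.sub_mem (hS c) (hS 0)
        rw [zero_smul, add_zero, add_sub_cancel_left] at this
        exact (W.smul_mem_iff hc).1 this
      have hlim := (tendsto_iteratedIntegral_prolong x hs ⟨hst.le, ht.2⟩ v k).mono_left
        (nhdsWithin_le_nhds (s := {0}ᶜ))
      have hcl := (W.closed_of_finiteDimensional).mem_of_tendsto hlim
        (eventually_nhdsWithin_of_forall hIc)
      rw [map_smul] at hcl
      exact (W.smul_mem_iff (sub_pos.2 hst).ne').1 hcl
    have hall : ∀ w v, tensorRight k w v ∈ W := by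
      intro w v
      have hw : w ∈ Submodule.span ℝ (range fun x : BVPath V hab => iteratedIntegral x k s) := by
        rw [ih s ⟨has, hst.le.trans ht.2⟩]; trivial
      induction hw using Submodule.span_induction with
      | zero => simp
      | add x₁ x₂ _ _ h₁ h₂ => rw [map_add, add_apply]; exact W.add_mem h₁ h₂
      | smul c x _ h => rw [map_smul, smul_apply]; exact W.smul_mem c h
      | mem x hx =>
        obtain ⟨x, rfl⟩ := hx
        exact hmem x v
    rw [eq_top_iff, ← span_range_elem (k + 1)]
    refine Submodule.span_le.2 ?_
    rintro _ ⟨w, rfl⟩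
    have := hall (elem (Fin.init w)) (w (Fin.last k))
    rwa [tensorRight_elem, Fin.snoc_init_self] at this

end Span

/-! ### Convergence and density in the completed tensor algebra -/

section Weighted

variable {V : Type u} [NormedAddCommGroup V] [InnerProductSpace ℝ V] [FiniteDimensional ℝ V]
  (φ : ℕ → ℝ≥0)

/-- The map `TPhi.level` as a linear map. -/
def TPhi.levelₗ (k : ℕ) : HSPower V k →ₗ[ℝ] TPhi V φ :=
  (UniformSpace.Completion.toComplₗᵢ (𝕜 := ℝ) (E := WTensor V φ)).toLinearMap ∘ₗ
    (toW φ).toLinearMap ∘ₗ DFinsupp.lsingle k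

lemma TPhi.levelₗ_apply (k : ℕ) (v : HSPower V k) : TPhi.levelₗ φ k v = TPhi.level φ k v := rfl

lemma TPhi.inner_level_self (k : ℕ) (v w : HSPower V k) :
    ⟪TPhi.level φ k v, TPhi.level φ k w⟫ = φ k * ⟪v, w⟫ := by
  rw [TPhi.level, TPhi.level, UniformSpace.Completion.inner_coe, inner_WTensor,
    tsum_eq_single k fun j hj => ?_]
  · simp [WTensor.comp]
  · simp [WTensor.comp, DFinsupp.single_eq_of_ne hj]

lemma TPhi.inner_level_of_ne {i j : ℕ} (h : i ≠ j) (v : HSPower V i) (w : HSPower V j) :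
    ⟪TPhi.level φ i v, TPhi.level φ j w⟫ = 0 := by
  rw [TPhi.level, TPhi.level, UniformSpace.Completion.inner_coe, inner_WTensor]
  refine (tsum_congr fun k => ?_).trans tsum_zero
  by_cases hk : k = i
  · subst hk
    simp [WTensor.comp, DFinsupp.single_eq_of_ne h]
  · simp [WTensor.comp, DFinsupp.single_eq_of_ne hk]

lemma TPhi.norm_level_sq (k : ℕ) (v : HSPower V k) :
    ‖TPhi.level φ k v‖ ^ 2 = φ k * ‖v‖ ^ 2 := by
  rw [← real_inner_self_eq_norm_sq, TPhi.inner_level_self, real_inner_self_eq_norm_sq]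

/-- Different levels are orthogonal, so summability is that of the squared norms; no summability of
norms is needed. -/
lemma TPhi.summable_level {v : (k : ℕ) → HSPower V k} (h : Summable fun k => φ k * ‖v k‖ ^ 2) :
    Summable fun k => TPhi.level φ k (v k) := by
  let G : ℕ → Submodule ℝ (TPhi V φ) := fun k => LinearMap.range (TPhi.levelₗ φ k)
  have hG : OrthogonalFamily ℝ (fun k => G k) fun k => (G k).subtypeₗᵢ := by
    rintro i j hij ⟨_, x, rfl⟩ ⟨_, y, rfl⟩
    exact TPhi.inner_level_of_ne φ hij x y
  refine (hG.summable_iff_norm_sq_summable fun k => ⟨TPhi.level φ k (v k), v k, rfl⟩).2 ?_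
  refine h.congr fun k => ?_
  rw [Submodule.coe_norm, TPhi.norm_level_sq]

lemma TPhi.eq_zero_of_inner_level {ℓ : TPhi V φ}
    (h : ∀ k (w : HSPower V k), ⟪ℓ, TPhi.level φ k w⟫ = 0) : ℓ = 0 := by
  refine (UniformSpace.Completion.denseRange_coe (α := WTensor V φ)).eq_zero_of_inner_left ℝ
    fun w => ?_
  obtain ⟨d, rfl⟩ := (toW φ).surjective w
  induction d using DFinsupp.induction with
  | h0 => rw [map_zero, UniformSpace.Completion.coe_zero, inner_zero_right]
  | ha k v d _ _ ih =>
    rw [map_add, UniformSpace.Completion.coe_add, inner_add_right, ih, add_zero]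
    exact h k v

variable {a b : ℝ} {hab : a < b}

lemma summable_level_signature
    (hφ : ∀ C : ℝ, 0 < C → Summable fun k : ℕ => C ^ k * (φ k : ℝ) / ((k.factorial : ℝ) ^ 2))
    (x : BVPath V hab) : Summable fun k => TPhi.level φ k (signature x k) := by
  refine TPhi.summable_level φ ?_
  set M := x.dMeasure.variation.real univ with hM
  -- The decay bound calls for `C = M ^ 2`; adding `1` keeps `C` positive when the path is constant.
  refine Summable.of_nonneg_of_le (fun k => by positivity) (fun k => ?_)
    (hφ (M ^ 2 + 1) (by positivity))
  have h := norm_iteratedIntegral_le x k b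
  calc (φ k : ℝ) * ‖signature x k‖ ^ 2 ≤ φ k * (M ^ k / k.factorial) ^ 2 := by
        gcongr; exact h
    _ = (M ^ 2) ^ k * φ k / (k.factorial : ℝ) ^ 2 := by rw [div_pow]; ring
    _ ≤ _ := by gcongr; linarith

theorem eq_zero_of_inner_signature
    (hφ : ∀ C : ℝ, 0 < C → Summable fun k : ℕ => C ^ k * (φ k : ℝ) / ((k.factorial : ℝ) ^ 2))
    {ℓ : TPhi V φ} (h : ∀ x : BVPath V hab, ⟪ℓ, TPhi.ofSeries φ (signature x)⟫ = 0) : ℓ = 0 := by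
  refine TPhi.eq_zero_of_inner_level φ fun k w => ?_
  have hS : ∀ x : BVPath V hab, ⟪ℓ, TPhi.level φ k (signature x k)⟫ = 0 := fun x => by
    -- Orthogonality to the signatures of all multiples `x.smul r` says that this power series in
    -- `r` sums to zero everywhere.
    refine eq_zero_of_hasSum_mul_pow (c := fun n => ⟪ℓ, TPhi.level φ n (signature x n)⟫)
      (fun r => ?_) k
    have hsum := ((innerSL ℝ ℓ).hasSum
      (summable_level_signature φ hφ (x.smul r)).hasSum)
    have h0 : innerSL ℝ ℓ (∑' n, TPhi.level φ n (signature (x.smul r) n)) = 0 := h (x.smul r)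
    rw [h0] at hsum
    refine hsum.congr_fun fun n => ?_
    simp only [innerSL_apply_apply]
    rw [signature_smul, ← TPhi.levelₗ_apply, ← TPhi.levelₗ_apply, map_smul,
      real_inner_smul_right, mul_comm]
  have hw : w ∈ Submodule.span ℝ (range fun x : BVPath V hab => iteratedIntegral x k b) := by
    rw [span_range_iteratedIntegral k b ⟨hab, le_rfl⟩]; trivial
  rw [← TPhi.levelₗ_apply]
  induction hw using Submodule.span_induction with
  | zero => simp
  | add x y _ _ hx hy => rw [map_add, inner_add_right, hx, hy, add_zero]
  | smul c x _ hx => rw [map_smul, real_inner_smul_right, hx, mul_zero]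
  | mem x hx =>
    obtain ⟨x, rfl⟩ := hx
    exact hS x

lemma UPath.exists_signature_eq (x : BVPath V hab) :
    ∃ y : UPath V hab, y.signature = SigKernel.signature x :=
  ⟨Quotient.mk _ x, rfl⟩

end Weighted

end SigKernel

end

/-! ### The representation theorem -/

open SigKernel in
theorem mainTheorem7 {V : Type*} [NormedAddCommGroup V] [InnerProductSpace ℝ V]
    [FiniteDimensional ℝ V] {a b : ℝ} (hab : a < b) (φ : ℕ → ℝ≥0)
    (hφ : ∀ C : ℝ, 0 < C → Summable fun k : ℕ => C ^ k * (φ k : ℝ) / ((k.factorial : ℝ) ^ 2)) :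
    (∀ x : UPath V hab, Summable fun k : ℕ => TPhi.level φ k (x.signature k)) ∧
    (∀ f : SigRKHS V φ hab, ∃! ℓ : TPhi V φ,
      ∀ x : UPath V hab, f x = ⟪ℓ, TPhi.ofSeries φ x.signature⟫) ∧
    ∃ Ψ : TPhi V φ ≃ₗᵢ[ℝ] SigRKHS V φ hab,
      ∀ (ℓ : TPhi V φ) (x : UPath V hab), Ψ ℓ x = ⟪ℓ, TPhi.ofSeries φ x.signature⟫ := by
  have hzero : ∀ ℓ : TPhi V φ,
      (∀ x : UPath V hab, ⟪ℓ, TPhi.ofSeries φ x.signature⟫ = 0) → ℓ = 0 := fun ℓ h =>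
    eq_zero_of_inner_signature (hab := hab) φ hφ fun x => by
      obtain ⟨y, hy⟩ := UPath.exists_signature_eq x
      rw [← hy]
      exact h y
  obtain ⟨Ψ, hΨ⟩ := exists_linearIsometryEquiv_rkhs (H := SigRKHS V φ hab)
    (fun x : UPath V hab => TPhi.ofSeries φ x.signature)
    (by
      rw [Submodule.topologicalClosure_eq_top_iff, Submodule.eq_bot_iff]
      intro ℓ hℓ
      refine hzero ℓ fun x => ?_
      rw [real_inner_comm]
      exact (Submodule.mem_orthogonal _ _).1 hℓ _ (Submodule.subset_span ⟨x, rfl⟩))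
    (fun x y => by rw [RKHS.OfKernel.kernel_ofKernel]; rfl)
  refine ⟨fun x => ?_, fun f => ⟨Ψ.symm f, fun x => ?_, fun ℓ hℓ => ?_⟩, Ψ, hΨ⟩
  · induction x using Quotient.inductionOn with
    | h x => exact summable_level_signature φ hφ x
  · rw [← hΨ, Ψ.apply_symm_apply]
  · rw [← sub_eq_zero]
    refine hzero _ fun x => ?_
    rw [inner_sub_left, ← hℓ, ← hΨ, Ψ.apply_symm_apply, sub_self]
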